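/- Start from the set $S_0=\{(0,1)^2\}$ whose only block is the open unit square. In one step choose a block $R=(a_1,b_1)\times(a_2,b_2)$ of the current set of blocks and a direction $i\in\{1,2\}$, and replace $R$ by the three open rectangles obtained from $R$ by replacing its $i$-th side $(a_i,b_i)$ by one of the three intervals $\left(a_i+\tfrac{j-1}{3}(b_i-a_i),\ a_i+\tfrac{j}{3}(b_i-a_i)\right)$, $j=1,2,3$. A set of blocks obtained by finitely many steps is called a triadic partition of the unit square. Let $C_{2,3}(n)$ be the number of distinct sets of blocks that can be obtained by exactly $m$ steps for some integer $m\ge 0$ with $n=1+2m$; two sequences of steps that produce the same set of blocks are counted once. Then, for every integer $n \ge 0$, the number of triadic partitions of the unit square into exactly $n$ rectangles is finite and equals $C_{2,3}(n)$. If $n$ is odd, then \[ C_{2,3}(n)=\frac1n\sum_{i=0}^{\lfloor (n-1)/8\rfloor}\binom{3\left(\frac{n-1}{2}-i\right)}{n-1,\ \frac{n-1}{2}-4i,\ i}(-1)^i\,2^{\frac{n-1}{2}-4i}, \] where $\binom{a+b+c}{a,\,b,\,c}=\frac{(a+b+c)!}{a!\,b!\,c!}$. If $n$ is even, then $C_{2,3}(n)=0$.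 -/

import Mathlib

open scoped Nat

/-- The open rectangle `(a₁, b₁) × ⋯ × (a_d, b_d)` in `ℝ^d`. -/
def openRect {d : ℕ} (a b : Fin d → ℝ) : Set (Fin d → ℝ) :=
  Set.univ.pi fun i => Set.Ioo (a i) (b i)

/-- The endpoint `c_i(j) = a_i + (j / p) (b_i - a_i)`. -/
noncomputable def cutPoint {d : ℕ} (p : ℕ) (a b : Fin d → ℝ) (i : Fin d) (j : ℕ) : ℝ :=
  a i + (j : ℝ) / (p : ℝ) * (b i - a i)

/-- The `p`-ary decomposition `H_i(R)` of the open rectangle `R` with corners `a`, `b`, orthogonal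
to the `i`-th coordinate axis: the `p` open rectangles obtained from `R` by replacing its `i`-th
side by one of the intervals `(c_i(j), c_i(j+1))`, `0 ≤ j < p`. -/
def axisCut {d : ℕ} (p : ℕ) (i : Fin d) (a b : Fin d → ℝ) : Set (Set (Fin d → ℝ)) :=
  {Q | ∃ j < p, Q = openRect (Function.update a i (cutPoint p a b i j))
    (Function.update b i (cutPoint p a b i (j + 1)))}

/-- `IsDecompositionAfter d p m S`: the set `S` of blocks can be obtained from the open unit
`d`-cube by `m` successive `p`-ary decompositions, each of them replacing one of the blocks `R`
that are present by the blocks of `H_i(R)` for some direction `i`. -/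
inductive IsDecompositionAfter (d p : ℕ) : ℕ → Set (Set (Fin d → ℝ)) → Prop
  | unitCube : IsDecompositionAfter d p 0 {openRect 0 1}
  | step {m : ℕ} {S : Set (Set (Fin d → ℝ))} (hS : IsDecompositionAfter d p m S)
      (a b : Fin d → ℝ) (hab : ∀ k, a k < b k) (hR : openRect a b ∈ S) (i : Fin d) :
      IsDecompositionAfter d p (m + 1) ((S \ {openRect a b}) ∪ axisCut p i a b)

/-- The set of all `(d, p, n)`-decompositions: the results of `m` steps, where
`n = 1 + m (p - 1)`. -/
def decompositions (d p n : ℕ) : Set (Set (Set (Fin d → ℝ))) :=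
  {S | ∃ m : ℕ, n = 1 + m * (p - 1) ∧ IsDecompositionAfter d p m S}

/-- `C_{d,p}(n)`, the number of distinct `(d, p, n)`-decompositions. -/
noncomputable def catalanC (d p n : ℕ) : ℕ :=
  (decompositions d p n).ncard

/-- The set of `p`-ary partitions of the open unit `d`-cube (results of any finite number of
steps) that consist of exactly `n` blocks. -/
def partitionsInto (d p n : ℕ) : Set (Set (Set (Fin d → ℝ))) :=
  {S | (∃ m : ℕ, IsDecompositionAfter d p m S) ∧ S.encard = n}

/-! Let T be the generating function of triadic partitions of the square by number of blocks. A
partition with more than one block has a first cut in one of the two directions, and its three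
thirds carry arbitrary partitions, so each direction contributes T^3. Both directions can serve as
first cut exactly when the partition refines the 3 × 3 grid with a partition in each cell, which
contributes T^9. Inclusion–exclusion gives T = X + 2T^3 - T^9 (`triadicSeries_eq`). Hence T is the
compositional inverse of X(1 - 2X^2 + X^8), and `lagrange_inversion` gives n[X^n]T = [X^(n-1)](1 -
2X^2 + X^8)^(-n), which `coeff_inv_pow_trinomial` expands. The geometric input is that cutting
blocks one at a time and recursive gluing give the same partitions (`mem_decompositions_iff`), and
that two possible first cuts force a grid (`exists_glue_glue_of_glue_eq_glue`). -/

/-! ### Lagrange inversion. -/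

open PowerSeries in
/-- The coefficient of `X ^ r` in `f' / g ^ (r + 1)`, where `f = X * g`, is the residue of
`f' / f ^ (r + 1)`. -/
theorem coeff_inv_pow_mul_derivative {g : ℚ⟦X⟧} (hg : constantCoeff g = 1) (r : ℕ) :
    coeff r (g⁻¹ ^ (r + 1) * d⁄dX ℚ (X * g)) = if r = 0 then 1 else 0 := by
  have hg0 : constantCoeff g ≠ 0 := by simp [hg]
  have hinv : g⁻¹ * g = 1 := PowerSeries.inv_mul_cancel g hg0
  have hd : d⁄dX ℚ (X * g) = g + X * d⁄dX ℚ g := by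
    simp [Derivation.leibniz, mul_comm]
  rcases r with _ | r
  · simp [hd, hg]
  -- This is the derivative of f^(-(r+1)) multiplied by -X^(r+2). A derivative has no residue: on
  -- the right, the two coefficients at X^(r+1) cancel.
  · have key : ((r + 1 : ℕ) : ℚ⟦X⟧) * (g⁻¹ ^ (r + 1 + 1) * d⁄dX ℚ (X * g)) =
        ((r + 1 : ℕ) : ℚ⟦X⟧) * g⁻¹ ^ (r + 1) - X * d⁄dX ℚ (g⁻¹ ^ (r + 1)) := by
      rw [hd, derivative_pow, derivative_inv']
      simp only [Nat.add_sub_cancel]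
      linear_combination (((r + 1 : ℕ) : ℚ⟦X⟧) * g⁻¹ ^ (r + 1)) * hinv
    have h2 := congrArg (coeff (r + 1)) key
    rw [map_sub, coeff_succ_X_mul, coeff_derivative, ← nsmul_eq_mul, ← nsmul_eq_mul, map_nsmul,
      map_nsmul, nsmul_eq_mul, nsmul_eq_mul] at h2
    have h3 : ((r + 1 : ℕ) : ℚ) ≠ 0 := by positivity
    rw [if_neg (Nat.succ_ne_zero r)]
    refine (mul_eq_zero.mp ?_).resolve_left h3
    rw [h2]; push_cast; ring

open PowerSeries in
/-- Lagrange inversion: the coefficients of the compositional inverse of `X * g`. -/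
theorem lagrange_inversion {g T : ℚ⟦X⟧} (hg : constantCoeff g = 1)
    (hT : T.subst (X * g) = (X : ℚ⟦X⟧)) (n : ℕ) :
    ((n + 1 : ℕ) : ℚ) * coeff (n + 1) T = coeff n (g⁻¹ ^ (n + 1)) := by
  have hg0 : constantCoeff g ≠ 0 := by simp [hg]
  have hinv : g⁻¹ * g = 1 := PowerSeries.inv_mul_cancel g hg0
  have hs : HasSubst (X * g : ℚ⟦X⟧) := HasSubst.of_constantCoeff_zero' (by simp)
  set f : ℚ⟦X⟧ := X * g with hf
  set G := d⁄dX ℚ T with hG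
  have h1 : G.subst f * d⁄dX ℚ f = 1 := by
    rw [hG, ← derivative_subst hs, hT, derivative_X]
  -- Truncation makes the substitution a finite sum; the tail stays divisible by X^(n+1) and cannot
  -- affect the coefficient at X^n.
  obtain ⟨R, hR⟩ : ∃ R : ℚ⟦X⟧, G = X ^ (n + 1) * R + ((trunc (n + 1) G : Polynomial ℚ) : ℚ⟦X⟧) := by
    obtain ⟨R, hR⟩ : (X : ℚ⟦X⟧) ^ (n + 1) ∣
        G - ((trunc (n + 1) G : Polynomial ℚ) : ℚ⟦X⟧) := by
      rw [X_pow_dvd_iff]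
      intro m hm
      simp [coeff_trunc, hm]
    exact ⟨R, by rw [← hR, sub_add_cancel]⟩
  have h2 : G.subst f = f ^ (n + 1) * R.subst f +
      ∑ k ∈ Finset.range (n + 1), C (coeff k G) * f ^ k := by
    conv_lhs => rw [hR]
    rw [subst_add hs, subst_mul hs, subst_pow hs, subst_X hs, subst_coe hs,
      Polynomial.aeval_eq_sum_range' (natDegree_trunc_lt G n)]
    congr 1
    refine Finset.sum_congr rfl fun k hk => ?_
    rw [coeff_trunc, if_pos (Finset.mem_range.mp hk), smul_eq_C_mul]
  -- Multiply by 1 = G(f) f' and use g^(-k) f^k = X^k. Term k then yields the residue at r = n - k,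
  -- so only k = n survives.
  have h3 : g⁻¹ ^ (n + 1) = X ^ (n + 1) * (R.subst f * d⁄dX ℚ f) +
      ∑ k ∈ Finset.range (n + 1),
        C (coeff k G) * (X ^ k * (g⁻¹ ^ (n - k + 1) * d⁄dX ℚ f)) := by
    have hp : ∀ k, g⁻¹ ^ k * f ^ k = X ^ k := fun k => by
      rw [← mul_pow, hf, mul_left_comm, hinv, mul_one]
    calc g⁻¹ ^ (n + 1) = g⁻¹ ^ (n + 1) * (G.subst f * d⁄dX ℚ f) := by rw [h1, mul_one]
      _ = _ := by
        rw [h2, add_mul, mul_add, Finset.sum_mul, Finset.mul_sum]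
        congr 1
        · rw [← hp]; ring
        · refine Finset.sum_congr rfl fun k hk => ?_
          have : n + 1 = (n - k + 1) + k := by
            have := Finset.mem_range.mp hk; omega
          rw [← hp k]
          conv_lhs => rw [this, pow_add]
          ring
  rw [h3, map_add, map_sum, coeff_X_pow_mul', if_neg (by omega), zero_add,
    Finset.sum_eq_single_of_mem n (by simp)]
  · rw [coeff_C_mul, coeff_X_pow_mul', if_pos le_rfl, Nat.sub_self,
      coeff_inv_pow_mul_derivative hg 0, if_pos rfl, hG, coeff_derivative]
    push_cast; ring
  · intro k hk hkn
    have := Finset.mem_range.mp hk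
    rw [coeff_C_mul, coeff_X_pow_mul', if_pos (by omega), coeff_inv_pow_mul_derivative hg,
      if_neg (by omega), mul_zero]

/-! ### Extracting the coefficients from the functional equation. -/

open PowerSeries in
theorem coeff_two_X_sq_sub_X_pow_eight_pow (M k : ℕ) :
    coeff (2 * M) ((2 * X ^ 2 - X ^ 8 : ℚ⟦X⟧) ^ k) =
      ∑ i ∈ Finset.range (k + 1),
        if k + 3 * i = M then (k.choose i : ℚ) * (-1) ^ i * 2 ^ (k - i) else 0 := by
  -- With this order of summands, the binomial index i counts the factors -X^8.
  rw [show (2 * X ^ 2 - X ^ 8 : ℚ⟦X⟧) = -X ^ 8 + 2 * X ^ 2 by ring, add_pow, map_sum]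
  refine Finset.sum_congr rfl fun i hi => ?_
  have hik : i ≤ k := by have := Finset.mem_range.mp hi; omega
  have : ((-X ^ 8 : ℚ⟦X⟧) ^ i * (2 * X ^ 2) ^ (k - i) * (k.choose i : ℚ⟦X⟧)) =
      C ((k.choose i : ℚ) * (-1) ^ i * 2 ^ (k - i)) * X ^ (2 * (k + 3 * i)) := by
    have e : 2 * (k + 3 * i) = 8 * i + 2 * (k - i) := by omega
    have hC : (C (2 : ℚ) : ℚ⟦X⟧) = 2 := map_ofNat C 2
    rw [e, pow_add, pow_mul, pow_mul, neg_pow, mul_pow]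
    simp only [map_mul, map_pow, map_natCast, map_neg, map_one, hC]
    ring
  rw [this, coeff_C_mul, coeff_X_pow]
  by_cases h : k + 3 * i = M
  · simp [h]
  · rw [if_neg h, if_neg (by omega), mul_zero]

-- Expand (1 - z)^(-(2M+1)) = Σ binom(2M+k, 2M) z^k. Degree 2M forces k = M - 3i, so 2M + k = 3(M -
-- i) and k - i = M - 4i, and the two binomials merge into a trinomial.
open PowerSeries in
theorem coeff_inv_pow_trinomial (M : ℕ) :
    coeff (2 * M) ((1 - (2 * X ^ 2 - X ^ 8) : ℚ⟦X⟧)⁻¹ ^ (2 * M + 1)) =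
      ∑ i ∈ Finset.range (M / 4 + 1),
        (((3 * (M - i))! : ℚ) / ((2 * M)! * (M - 4 * i)! * (i)!)) * (-1) ^ i * 2 ^ (M - 4 * i) := by
  set z : ℚ⟦X⟧ := 2 * X ^ 2 - X ^ 8 with hz
  have hs : HasSubst z := HasSubst.of_constantCoeff_zero' (by simp [hz])
  have hinv : (1 - z)⁻¹ * (1 - z) = 1 :=
    PowerSeries.inv_mul_cancel _ (by simp [hz])
  set F : ℚ⟦X⟧ := mk fun k => ((2 * M + k).choose (2 * M) : ℚ) with hF
  have h1 : F.subst z * (1 - z) ^ (2 * M + 1) = 1 := by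
    have := congrArg (substAlgHom hs) (mk_add_choose_mul_one_sub_pow_eq_one ℚ (2 * M))
    rwa [map_mul, map_pow, map_sub, map_one, substAlgHom_X, coe_substAlgHom] at this
  have h2 : (1 - z)⁻¹ ^ (2 * M + 1) = F.subst z := by
    calc (1 - z)⁻¹ ^ (2 * M + 1) = F.subst z * ((1 - z)⁻¹ * (1 - z)) ^ (2 * M + 1) := by
          rw [mul_pow, mul_left_comm, h1, mul_one]
      _ = _ := by rw [hinv, one_pow, mul_one]
  have hterm : ∀ k, coeff k F • coeff (2 * M) (z ^ k) =
      ∑ i ∈ Finset.range (M + 1), if k + 3 * i = M then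
        ((2 * M + k).choose (2 * M) : ℚ) * (k.choose i : ℚ) * (-1) ^ i * 2 ^ (k - i) else 0 := by
    intro k
    -- The range of i is made independent of k, so that the two sums can be interchanged.
    have hsub : ∑ i ∈ Finset.range (k + 1),
        (if k + 3 * i = M then (k.choose i : ℚ) * (-1) ^ i * 2 ^ (k - i) else 0) =
        ∑ i ∈ Finset.range (M + 1),
        (if k + 3 * i = M then (k.choose i : ℚ) * (-1) ^ i * 2 ^ (k - i) else 0) := by
      trans ∑ i ∈ Finset.range (max (k + 1) (M + 1)),
        (if k + 3 * i = M then (k.choose i : ℚ) * (-1) ^ i * 2 ^ (k - i) else 0)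
      · refine Finset.sum_subset (Finset.range_mono (le_max_left _ _)) fun i _ hi => ?_
        rw [Finset.mem_range] at hi
        rw [Nat.choose_eq_zero_of_lt (by omega)]
        simp
      · refine (Finset.sum_subset (Finset.range_mono (le_max_right _ _)) fun i _ hi => ?_).symm
        rw [Finset.mem_range] at hi
        rw [if_neg (by omega)]
    rw [coeff_two_X_sq_sub_X_pow_eight_pow, hsub, smul_eq_mul, Finset.mul_sum]
    refine Finset.sum_congr rfl fun i _ => ?_
    rw [hF, coeff_mk, mul_ite, mul_zero]
    simp only [mul_assoc]
  rw [h2, coeff_subst' hs, finsum_congr hterm,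
    finsum_eq_sum_of_support_subset (s := Finset.range (M + 1)), Finset.sum_comm]
  · symm
    refine Finset.sum_subset_zero_on_sdiff (Finset.range_mono (by omega)) ?_ ?_
    -- For i > M / 4 the only candidate k = M - 3i is less than i, and `k.choose i` vanishes.
    · intro i hi
      rw [Finset.mem_sdiff, Finset.mem_range, Finset.mem_range] at hi
      refine Finset.sum_eq_zero fun k _ => ?_
      split_ifs with h
      · rw [Nat.choose_eq_zero_of_lt (by omega : k < i)]; simp
      · rfl
    · intro i hi
      have hi4 : 4 * i ≤ M := by have := Finset.mem_range.mp hi; omega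
      obtain ⟨c, rfl⟩ := Nat.exists_eq_add_of_le hi4
      rw [Finset.sum_eq_single (i + c)]
      · rw [if_pos (by omega), Nat.cast_choose ℚ (by omega), Nat.cast_choose ℚ (by omega)]
        have e1 : 3 * (4 * i + c - i) = 2 * (4 * i + c) + (i + c) := by omega
        have e2 : 2 * (4 * i + c) + (i + c) - 2 * (4 * i + c) = i + c := by omega
        have e3 : i + c - i = c := by omega
        have e4 : 4 * i + c - 4 * i = c := by omega
        rw [e1, e2, e3, e4]
        have := Nat.factorial_ne_zero (i + c)
        field_simp
      · intro k _ hk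
        rw [if_neg (by omega)]
      · intro h
        exact absurd (Finset.mem_range.mpr (by omega)) h
  · intro k hk
    rw [Function.mem_support] at hk
    obtain ⟨i, _, hi⟩ := Finset.exists_ne_zero_of_sum_ne_zero hk
    have : k + 3 * i = M := by by_contra h; exact hi (if_neg h)
    simp only [Finset.coe_range, Set.mem_Iio]; omega

-- With f the substituted series, V = T(f) and X both solve Y - 2Y^3 + Y^9 = f. The difference of
-- the two equations is V - X times a series with constant term 1, so V = X.
open PowerSeries in
theorem subst_eq_X_of_functional_equation {T : ℚ⟦X⟧} (h0 : constantCoeff T = 0)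
    (hT : T = X + 2 * T ^ 3 - T ^ 9) :
    T.subst (X * (1 - (2 * X ^ 2 - X ^ 8)) : ℚ⟦X⟧) = (X : ℚ⟦X⟧) := by
  set f : ℚ⟦X⟧ := X * (1 - (2 * X ^ 2 - X ^ 8)) with hf
  have hs : HasSubst f := HasSubst.of_constantCoeff_zero' (by simp [hf])
  set V : ℚ⟦X⟧ := T.subst f with hV
  have hV0 : constantCoeff V = 0 :=
    constantCoeff_subst_eq_zero (a := f) (by simp [hf, ← constantCoeff.eq_def]) T h0
  have hVf : V = f + 2 * V ^ 3 - V ^ 9 := by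
    have := congrArg (substAlgHom hs) hT
    rwa [map_sub, map_add, map_mul, map_pow, map_pow, substAlgHom_X, map_ofNat,
      coe_substAlgHom] at this
  have hprod : (V - X) * (1 - 2 * (V ^ 2 + V * X + X ^ 2) + (V ^ 8 + V ^ 7 * X + V ^ 6 * X ^ 2 +
      V ^ 5 * X ^ 3 + V ^ 4 * X ^ 4 + V ^ 3 * X ^ 5 + V ^ 2 * X ^ 6 + V * X ^ 7 + X ^ 8)) = 0 := by
    linear_combination hVf + hf
  rcases mul_eq_zero.mp hprod with h | h
  · exact sub_eq_zero.mp h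
  · have := congrArg constantCoeff h
    simp [hV0] at this

open PowerSeries in
theorem coeff_of_functional_equation {T : ℚ⟦X⟧} (h0 : constantCoeff T = 0)
    (hT : T = X + 2 * T ^ 3 - T ^ 9) (M : ℕ) :
    coeff (2 * M + 1) T = 1 / ((2 * M + 1 : ℕ) : ℚ) * ∑ i ∈ Finset.range (M / 4 + 1),
        (((3 * (M - i))! : ℚ) / ((2 * M)! * (M - 4 * i)! * (i)!)) * (-1) ^ i *
          2 ^ (M - 4 * i) := by
  rw [← coeff_inv_pow_trinomial, ← lagrange_inversion (by simp)
    (subst_eq_X_of_functional_equation h0 hT), one_div, inv_mul_cancel_left₀]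
  positivity

/-! ### Thirds of the cube, gluing, and the recursive form of triadic partitions. -/

section Geometry

variable {d : ℕ}

/-- The affine contraction of the unit cube onto its `j`-th third in direction `i`. -/
noncomputable def third (i : Fin d) (j : Fin 3) (x : Fin d → ℝ) : Fin d → ℝ :=
  Function.update x i ((x i + (j : ℕ)) / 3)

theorem third_same (i : Fin d) (j : Fin 3) (x : Fin d → ℝ) :
    third i j x i = (x i + (j : ℕ)) / 3 := by
  simp [third]

theorem third_of_ne {i k : Fin d} (h : k ≠ i) (j : Fin 3) (x : Fin d → ℝ) :
    third i j x k = x k := by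
  simp [third, h]

theorem third_injective (i : Fin d) (j : Fin 3) : Function.Injective (third i j) := by
  intro x y h
  ext k
  have hk := congrFun h k
  by_cases hki : k = i
  · subst hki
    rw [third_same, third_same] at hk
    linarith
  · rwa [third_of_ne hki, third_of_ne hki] at hk

theorem third_comm {i i' : Fin d} (h : i ≠ i') (j k : Fin 3) (x : Fin d → ℝ) :
    third i j (third i' k x) = third i' k (third i j x) := by
  rw [third, third_of_ne h, third, third, third_of_ne h.symm, third, Function.update_comm h]

theorem mem_openRect {a b x : Fin d → ℝ} : x ∈ openRect a b ↔ ∀ k, a k < x k ∧ x k < b k := by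
  simp [openRect]

theorem image_third_openRect (i : Fin d) (j : Fin 3) (a b : Fin d → ℝ) :
    third i j '' openRect a b = openRect (third i j a) (third i j b) := by
  ext x
  constructor
  · rintro ⟨y, hy, rfl⟩
    rw [mem_openRect] at hy ⊢
    intro k
    by_cases hki : k = i
    · subst hki
      simp only [third_same]
      constructor <;> linarith [(hy k).1, (hy k).2]
    · simpa only [third_of_ne hki] using hy k
  · intro hx
    rw [mem_openRect] at hx
    refine ⟨Function.update x i (3 * x i - (j : ℕ)), ?_, ?_⟩
    · rw [mem_openRect]
      intro k
      have hk := hx k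
      by_cases hki : k = i
      · subst hki
        simp only [third_same] at hk
        simp only [Function.update_self]
        constructor <;> linarith [hk.1, hk.2]
      · simpa only [third_of_ne hki, Function.update_of_ne hki] using hk
    · simp [third]

theorem openRect_nonempty {a b : Fin d → ℝ} (h : ∀ k, a k < b k) : (openRect a b).Nonempty :=
  ⟨fun k => (a k + b k) / 2, mem_openRect.mpr fun k => by
    constructor <;> linarith [h k]⟩

theorem openRect_injective {a b a' b' : Fin d → ℝ} (h : ∀ k, a k < b k)
    (heq : openRect a b = openRect a' b') : a = a' ∧ b = b' := by
  have hne : (Set.univ.pi fun k => Set.Ioo (a' k) (b' k)).Nonempty := by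
    have := openRect_nonempty h
    rwa [heq] at this
  have key : ∀ k, Set.Ioo (a k) (b k) = Set.Ioo (a' k) (b' k) := by
    intro k
    have h1 := Set.eval_image_univ_pi (i := k) (openRect_nonempty h)
    have h2 := Set.eval_image_univ_pi (i := k) hne
    rw [← h1, ← h2]
    exact congrArg _ heq
  have h' : ∀ k, a' k < b' k := fun k => by
    have : (Set.Ioo (a' k) (b' k)).Nonempty := by rw [← key k]; exact Set.nonempty_Ioo.mpr (h k)
    exact Set.nonempty_Ioo.mp this
  constructor <;> ext k
  · rw [← csInf_Ioo (h k), key k, csInf_Ioo (h' k)]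
  · rw [← csSup_Ioo (h k), key k, csSup_Ioo (h' k)]

theorem image_third_subset (i : Fin d) (j : Fin 3) {Q : Set (Fin d → ℝ)}
    (hQ : Q ⊆ openRect 0 1) : third i j '' Q ⊆ openRect 0 1 := by
  rintro _ ⟨x, hx, rfl⟩
  have hx' := mem_openRect.mp (hQ hx)
  rw [mem_openRect]
  intro k
  have hj : ((j : ℕ) : ℝ) ≤ 2 := by exact_mod_cast Nat.le_of_lt_succ j.isLt
  have hj0 : (0 : ℝ) ≤ (j : ℕ) := by positivity
  have hk := hx' k
  simp only [Pi.zero_apply, Pi.one_apply] at hk ⊢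
  by_cases hki : k = i
  · subst hki
    rw [third_same]
    constructor <;> linarith
  · rwa [third_of_ne hki]

/-- Distinct open thirds are disjoint: coordinates in (0, 1) force |j - k| < 1. -/
theorem eq_of_third_eq {i : Fin d} {j k : Fin 3} {x y : Fin d → ℝ}
    (hx : x ∈ openRect (0 : Fin d → ℝ) 1) (hy : y ∈ openRect (0 : Fin d → ℝ) 1)
    (h : third i j x = third i k y) : j = k := by
  have hi := congrFun h i
  rw [third_same, third_same] at hi
  have hxi := mem_openRect.mp hx i
  have hyi := mem_openRect.mp hy i
  simp only [Pi.zero_apply, Pi.one_apply] at hxi hyi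
  have h1 : ((j : ℕ) : ℝ) < (k : ℕ) + 1 := by linarith
  have h2 : ((k : ℕ) : ℝ) < (j : ℕ) + 1 := by linarith
  norm_cast at h1 h2
  ext
  omega

/-- A block that lies in a third in direction `i'` still does so if it is expanded in another
direction. -/
theorem subset_image_third_of_image_subset {i i' : Fin d} (h : i' ≠ i) {j k : Fin 3}
    {Q : Set (Fin d → ℝ)} (hQ : Q ⊆ openRect 0 1)
    (hsub : third i j '' Q ⊆ third i' k '' openRect 0 1) : Q ⊆ third i' k '' openRect 0 1 := by
  intro x hx
  have h1 := hsub ⟨x, hx, rfl⟩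
  rw [image_third_openRect, mem_openRect] at h1 ⊢
  intro l
  by_cases hl : l = i'
  · subst hl
    have := h1 l
    rwa [third_of_ne h] at this
  · rw [third_of_ne hl, third_of_ne hl]
    exact mem_openRect.mp (hQ hx) l

/-! ### Gluing three families of blocks -/

/-- A family of nonempty blocks inside the open unit cube. -/
def IsBlockFamily (S : Set (Set (Fin d → ℝ))) : Prop :=
  ∀ Q ∈ S, Q.Nonempty ∧ Q ⊆ openRect 0 1

/-- Cut the unit cube into thirds in direction `i` and subdivide the `j`-th third by a scaled
copy of `S j`. -/
def glue (i : Fin d) (S : Fin 3 → Set (Set (Fin d → ℝ))) : Set (Set (Fin d → ℝ)) :=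
  ⋃ j, Set.image (third i j) '' S j

theorem mem_glue {i : Fin d} {S : Fin 3 → Set (Set (Fin d → ℝ))} {Q : Set (Fin d → ℝ)} :
    Q ∈ glue i S ↔ ∃ j, ∃ R ∈ S j, third i j '' R = Q := by
  simp [glue]

theorem eq_of_image_third_eq {i : Fin d} {j k : Fin 3} {Q R : Set (Fin d → ℝ)}
    (hQ : Q.Nonempty) (hQ' : Q ⊆ openRect 0 1) (hR : R ⊆ openRect 0 1)
    (h : third i j '' Q = third i k '' R) : j = k ∧ Q = R := by
  obtain ⟨x, hx⟩ := hQ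
  have : third i j x ∈ third i k '' R := h ▸ ⟨x, hx, rfl⟩
  obtain ⟨y, hy, hyx⟩ := this
  have hjk : j = k := eq_of_third_eq (hQ' hx) (hR hy) hyx.symm
  subst hjk
  exact ⟨rfl, (third_injective i j).image_injective h⟩

/-- Nonempty blocks inside the cube reveal the third they were placed in, so each piece can be read
off the glued family. -/
theorem image_third_mem_glue {i : Fin d} {S : Fin 3 → Set (Set (Fin d → ℝ))}
    (hS : ∀ j, IsBlockFamily (S j)) {j : Fin 3} {Q : Set (Fin d → ℝ)} (hQ : Q ⊆ openRect 0 1) :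
    third i j '' Q ∈ glue i S ↔ Q ∈ S j := by
  rw [mem_glue]
  constructor
  · rintro ⟨k, R, hR, h⟩
    obtain ⟨rfl, rfl⟩ := eq_of_image_third_eq (hS k R hR).1 (hS k R hR).2 hQ h
    exact hR
  · exact fun h => ⟨j, Q, h, rfl⟩

theorem isBlockFamily_glue {i : Fin d} {S : Fin 3 → Set (Set (Fin d → ℝ))}
    (hS : ∀ j, IsBlockFamily (S j)) : IsBlockFamily (glue i S) := by
  intro Q hQ
  obtain ⟨j, R, hR, rfl⟩ := mem_glue.mp hQ
  exact ⟨(hS j R hR).1.image _, image_third_subset i j (hS j R hR).2⟩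

theorem glue_injective {i : Fin d} {S T : Fin 3 → Set (Set (Fin d → ℝ))}
    (hS : ∀ j, IsBlockFamily (S j)) (hT : ∀ j, IsBlockFamily (T j)) (h : glue i S = glue i T) :
    S = T := by
  funext j
  ext Q
  constructor
  · intro hQ
    have hQ' := (hS j Q hQ).2
    rwa [← image_third_mem_glue (i := i) hT hQ', ← h, image_third_mem_glue hS hQ']
  · intro hQ
    have hQ' := (hT j Q hQ).2
    rwa [← image_third_mem_glue (i := i) hS hQ', h, image_third_mem_glue hT hQ']

/-- A 3 × 3 grid arises from cutting in either order. -/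
theorem glue_comm {i i' : Fin d} (h : i ≠ i') (S : Fin 3 → Fin 3 → Set (Set (Fin d → ℝ))) :
    glue i (fun j => glue i' (S j)) = glue i' (fun k => glue i fun j => S j k) := by
  have himage : ∀ (j k : Fin 3) (R : Set (Fin d → ℝ)),
      third i j '' (third i' k '' R) = third i' k '' (third i j '' R) := fun j k R => by
    rw [Set.image_image, Set.image_image]
    exact Set.image_congr fun x _ => third_comm h j k x
  ext Q
  simp only [mem_glue]
  constructor
  · rintro ⟨j, _, ⟨k, R, hR, rfl⟩, rfl⟩
    exact ⟨k, _, ⟨j, R, hR, rfl⟩, (himage j k R).symm⟩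
  · rintro ⟨k, _, ⟨j, R, hR, rfl⟩, rfl⟩
    exact ⟨j, _, ⟨k, R, hR, rfl⟩, himage j k R⟩

/-- Transports a cut inside one third to the whole cube; disjointness of the thirds ensures that
only one block is removed. -/
theorem glue_update {i : Fin d} {S : Fin 3 → Set (Set (Fin d → ℝ))}
    (hS : ∀ j, IsBlockFamily (S j)) {j : Fin 3} {Q : Set (Fin d → ℝ)} (hQ : Q ∈ S j)
    (C : Set (Set (Fin d → ℝ))) :
    glue i (Function.update S j ((S j \ {Q}) ∪ C)) =
      (glue i S \ {third i j '' Q}) ∪ Set.image (third i j) '' C := by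
  ext P
  simp only [Set.mem_union, Set.mem_sdiff, Set.mem_singleton_iff, mem_glue, Set.mem_image]
  constructor
  · rintro ⟨k, R, hR, rfl⟩
    by_cases hkj : k = j
    · subst hkj
      rw [Function.update_self] at hR
      rcases hR with ⟨hR, hRQ⟩ | hR
      · exact Or.inl ⟨⟨k, R, hR, rfl⟩, fun h => hRQ ((third_injective i k).image_injective h)⟩
      · exact Or.inr ⟨R, hR, rfl⟩
    · rw [Function.update_of_ne hkj] at hR
      refine Or.inl ⟨⟨k, R, hR, rfl⟩, fun h => hkj ?_⟩
      exact (eq_of_image_third_eq (hS k R hR).1 (hS k R hR).2 (hS j Q hQ).2 h).1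
  · rintro (⟨⟨k, R, hR, rfl⟩, hne⟩ | ⟨R, hR, rfl⟩)
    · refine ⟨k, R, ?_, rfl⟩
      by_cases hkj : k = j
      · subst hkj
        rw [Function.update_self]
        exact Or.inl ⟨hR, fun h => hne (by rw [Set.mem_singleton_iff.mp h])⟩
      · rwa [Function.update_of_ne hkj]
    · exact ⟨j, R, by rw [Function.update_self]; exact Or.inr hR, rfl⟩

/-! ### Triadic cuts -/

theorem image_third_axisCut (i k : Fin d) (j : Fin 3) (a b : Fin d → ℝ) :
    Set.image (third i j) '' axisCut 3 k a b = axisCut 3 k (third i j a) (third i j b) := by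
  have hupd : ∀ (c : Fin d → ℝ) (l : ℕ),
      third i j (Function.update c k (cutPoint 3 a b k l)) =
        Function.update (third i j c) k (cutPoint 3 (third i j a) (third i j b) k l) := by
    intro c l
    ext m
    by_cases hmk : m = k
    · subst hmk
      by_cases hmi : m = i
      · subst hmi
        simp only [third_same, Function.update_self, cutPoint]
        push_cast; ring
      · simp only [third_of_ne hmi, Function.update_self, cutPoint]
    · by_cases hmi : m = i
      · subst hmi
        simp only [third_same, Function.update_of_ne hmk]
      · simp only [third_of_ne hmi, Function.update_of_ne hmk]
  ext Q
  simp only [axisCut, Set.mem_image, Set.mem_ofPred_eq]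
  constructor
  · rintro ⟨_, ⟨l, hl, rfl⟩, rfl⟩
    exact ⟨l, hl, by rw [image_third_openRect, hupd, hupd]⟩
  · rintro ⟨l, hl, rfl⟩
    exact ⟨_, ⟨l, hl, rfl⟩, by rw [image_third_openRect, hupd, hupd]⟩

theorem axisCut_unitCube (i : Fin d) :
    axisCut 3 i 0 1 = glue i fun _ => {openRect (0 : Fin d → ℝ) 1} := by
  have h0 : ∀ j : Fin 3, third i j 0 = Function.update (0 : Fin d → ℝ) i (cutPoint 3 (0 : Fin d → ℝ) 1 i j) := by
    intro j
    simp [third, cutPoint]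
  have h1 : ∀ j : Fin 3, third i j 1 = Function.update (1 : Fin d → ℝ) i (cutPoint 3 (0 : Fin d → ℝ) 1 i (j + 1)) := by
    intro j
    simp [third, cutPoint, add_comm]
  ext Q
  simp only [axisCut, mem_glue, Set.mem_ofPred_eq, Set.mem_singleton_iff, exists_eq_left]
  constructor
  · rintro ⟨j, hj, rfl⟩
    exact ⟨⟨j, hj⟩, by rw [image_third_openRect, h0, h1]⟩
  · rintro ⟨j, rfl⟩
    exact ⟨j, j.isLt, by rw [image_third_openRect, h0, h1]⟩

/-! ### Triadic partitions, built from the top -/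

/-- `IsTriadic n S`: the unit cube is either undivided, or it is cut into thirds and each third
carries a scaled triadic partition; `n` counts the blocks. -/
inductive IsTriadic : ℕ → Set (Set (Fin d → ℝ)) → Prop
  | unitCube : IsTriadic 1 {openRect 0 1}
  | glued (i : Fin d) (n : Fin 3 → ℕ) (S : Fin 3 → Set (Set (Fin d → ℝ)))
      (h : ∀ j, IsTriadic (n j) (S j)) : IsTriadic (∑ j, n j) (glue i S)

theorem unitCube_lt (k : Fin d) : (0 : Fin d → ℝ) k < (1 : Fin d → ℝ) k := by simp

theorem isBlockFamily_unitCube : IsBlockFamily {openRect (0 : Fin d → ℝ) 1} := by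
  rintro Q rfl
  exact ⟨openRect_nonempty unitCube_lt, subset_rfl⟩

theorem IsTriadic.isBlockFamily {n : ℕ} {S : Set (Set (Fin d → ℝ))} (h : IsTriadic n S) :
    IsBlockFamily S := by
  induction h with
  | unitCube => exact isBlockFamily_unitCube
  | glued i n S _ ih => exact isBlockFamily_glue ih

theorem IsTriadic.exists_eq_openRect {n : ℕ} {S : Set (Set (Fin d → ℝ))} (h : IsTriadic n S) :
    ∀ Q ∈ S, ∃ a b, (∀ k, a k < b k) ∧ Q = openRect a b := by
  induction h with
  | unitCube => rintro Q rfl; exact ⟨0, 1, unitCube_lt, rfl⟩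
  | glued i n S _ ih =>
    intro Q hQ
    obtain ⟨j, R, hR, rfl⟩ := mem_glue.mp hQ
    obtain ⟨a, b, hab, rfl⟩ := ih j R hR
    refine ⟨third i j a, third i j b, fun k => ?_, image_third_openRect i j a b⟩
    by_cases hki : k = i
    · subst hki
      rw [third_same, third_same]
      linarith [hab k]
    · rw [third_of_ne hki, third_of_ne hki]
      exact hab k

theorem IsTriadic.pos {n : ℕ} {S : Set (Set (Fin d → ℝ))} (h : IsTriadic n S) : 0 < n := by
  induction h with
  | unitCube => exact one_pos
  | glued i n S _ ih => exact Finset.sum_pos (fun j _ => ih j) Finset.univ_nonempty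

/-- The index is thus determined by the partition, so different indices give disjoint classes to
count. -/
theorem IsTriadic.encard_eq {n : ℕ} {S : Set (Set (Fin d → ℝ))} (h : IsTriadic n S) :
    S.encard = n := by
  induction h with
  | unitCube => simp
  | glued i n S h ih =>
    have hdis : Pairwise (Function.onFun Disjoint fun j => Set.image (third i j) '' S j) := by
      intro j k hjk
      rw [Function.onFun, Set.disjoint_left]
      rintro _ ⟨Q, hQ, rfl⟩ ⟨R, hR, hRQ⟩
      exact hjk (eq_of_image_third_eq ((h k).isBlockFamily R hR).1 ((h k).isBlockFamily R hR).2
        ((h j).isBlockFamily Q hQ).2 hRQ).1.symm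
    have hcard : ∀ j, (Set.image (third i j) '' S j).encard = n j := fun j => by
      rw [(third_injective i j).image_injective.encard_image, ih]
    rw [glue, Set.encard_iUnion_of_finite hdis, finsum_eq_sum_of_fintype]
    simp [hcard]

theorem IsTriadic.eq_of_eq {m n : ℕ} {S : Set (Set (Fin d → ℝ))} (h : IsTriadic m S)
    (h' : IsTriadic n S) : m = n := by
  have := h.encard_eq.symm.trans h'.encard_eq
  exact_mod_cast this

theorem sum_update_add_two (n : Fin 3 → ℕ) (j : Fin 3) :
    ∑ k, Function.update n j (n j + 2) k = ∑ k, n k + 2 := by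
  rw [Finset.sum_update_of_mem (Finset.mem_univ j),
    Finset.sum_eq_add_sum_sdiff_singleton j n fun h => absurd (Finset.mem_univ j) h]
  omega

theorem forall_update {ι α β : Type*} [DecidableEq ι] {p : α → β → Prop} {n : ι → α}
    {S : ι → β} (h : ∀ k, p (n k) (S k)) {j : ι} {m : α} {T : β} (hj : p m T) (k : ι) :
    p (Function.update n j m k) (Function.update S j T k) := by
  by_cases hk : k = j
  · subst hk; simpa using hj
  · simpa [hk] using h k

/-- Cutting a block of a triadic partition yields a triadic partition. -/
theorem IsTriadic.cut {n : ℕ} {S : Set (Set (Fin d → ℝ))} (h : IsTriadic n S) (i : Fin d) :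
    ∀ a b : Fin d → ℝ, (∀ k, a k < b k) → openRect a b ∈ S →
      IsTriadic (n + 2) ((S \ {openRect a b}) ∪ axisCut 3 i a b) := by
  induction h with
  | unitCube =>
    intro a b hab hmem
    obtain ⟨rfl, rfl⟩ := openRect_injective hab (Set.mem_singleton_iff.mp hmem)
    rw [Set.sdiff_self, Set.empty_union, axisCut_unitCube]
    exact IsTriadic.glued i (fun _ => 1) _ fun _ => IsTriadic.unitCube
  | glued k n S h ih =>
    intro a b hab hmem
    obtain ⟨j, Q, hQ, hQab⟩ := mem_glue.mp hmem
    obtain ⟨a', b', hab', rfl⟩ := (h j).exists_eq_openRect Q hQ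
    rw [image_third_openRect] at hQab
    obtain ⟨rfl, rfl⟩ := openRect_injective hab hQab.symm
    rw [← image_third_openRect, ← image_third_axisCut,
      ← glue_update (fun j => (h j).isBlockFamily) hQ, ← sum_update_add_two n j]
    exact IsTriadic.glued k _ _ (forall_update h (ih j a' b' hab' hQ))

/-- A triadic partition with more than one block arises by cutting a block of a smaller one. -/
theorem IsTriadic.exists_cut {n : ℕ} {S : Set (Set (Fin d → ℝ))} (h : IsTriadic n S) :
    (n = 1 ∧ S = {openRect 0 1}) ∨
      ∃ (m : ℕ) (T : Set (Set (Fin d → ℝ))) (a b : Fin d → ℝ) (i : Fin d), IsTriadic m T ∧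
        n = m + 2 ∧ (∀ k, a k < b k) ∧ openRect a b ∈ T ∧
          S = (T \ {openRect a b}) ∪ axisCut 3 i a b := by
  induction h with
  | unitCube => exact Or.inl ⟨rfl, rfl⟩
  | glued i n S h ih =>
    right
    -- If no third is divided, the first cut is also the last; otherwise a last cut is taken inside
    -- a divided third.
    by_cases hall : ∀ j, n j = 1 ∧ S j = {openRect 0 1}
    · refine ⟨1, {openRect 0 1}, 0, 1, i, IsTriadic.unitCube, ?_, unitCube_lt, rfl, ?_⟩
      · simp [fun j => (hall j).1]
      · rw [Set.sdiff_self, Set.empty_union, axisCut_unitCube]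
        exact congrArg _ (funext fun j => (hall j).2)
    · obtain ⟨j, hj⟩ := not_forall.mp hall
      obtain ⟨m, T, a, b, k, hT, hn, hab, hmem, hS⟩ := (ih j).resolve_left hj
      have h' := forall_update h (j := j) hT
      have hmem' : openRect a b ∈ Function.update S j T j := by rwa [Function.update_self]
      refine ⟨_, _, third i j a, third i j b, k, IsTriadic.glued i _ _ h', ?_, fun l => ?_, ?_, ?_⟩
      · rw [← sum_update_add_two _ j, Function.update_idem, Function.update_self, ← hn,
          Function.update_eq_self]
      · by_cases hl : l = i
        · subst hl
          rw [third_same, third_same]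
          linarith [hab l]
        · rw [third_of_ne hl, third_of_ne hl]
          exact hab l
      · rw [← image_third_openRect]
        exact mem_glue.mpr ⟨j, _, hmem', rfl⟩
      · rw [← image_third_openRect, ← image_third_axisCut,
          ← glue_update (fun j => (h' j).isBlockFamily) hmem', Function.update_idem,
          Function.update_self, ← hS, Function.update_eq_self]

theorem IsDecompositionAfter.isTriadic {m : ℕ} {S : Set (Set (Fin d → ℝ))}
    (h : IsDecompositionAfter d 3 m S) : IsTriadic (1 + m * 2) S := by
  induction h with
  | unitCube => exact IsTriadic.unitCube
  | step _ a b hab hR i ih =>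
    rw [add_mul, ← add_assoc]
    exact ih.cut i a b hab hR

theorem IsTriadic.exists_isDecompositionAfter {n : ℕ} {S : Set (Set (Fin d → ℝ))}
    (h : IsTriadic n S) : ∃ m, n = 1 + m * 2 ∧ IsDecompositionAfter d 3 m S := by
  induction n using Nat.strong_induction_on generalizing S with
  | _ n ih =>
    rcases h.exists_cut with ⟨rfl, rfl⟩ | ⟨m, T, a, b, i, hT, rfl, hab, hmem, rfl⟩
    · exact ⟨0, rfl, IsDecompositionAfter.unitCube⟩
    · obtain ⟨l, rfl, hl⟩ := ih m (by omega) hT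
      exact ⟨l + 1, by ring, hl.step a b hab hmem i⟩

theorem mem_decompositions_iff {n : ℕ} {S : Set (Set (Fin d → ℝ))} :
    S ∈ decompositions d 3 n ↔ IsTriadic n S := by
  constructor
  · rintro ⟨m, rfl, h⟩
    exact h.isTriadic
  · exact fun h => h.exists_isDecompositionAfter

theorem partitionsInto_eq_decompositions (n : ℕ) :
    partitionsInto d 3 n = decompositions d 3 n := by
  ext S
  constructor
  · rintro ⟨⟨m, h⟩, hn⟩
    have := h.isTriadic.encard_eq.symm.trans hn
    exact ⟨m, by exact_mod_cast this.symm, h⟩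
  · rintro ⟨m, hm, h⟩
    exact ⟨⟨m, h⟩, (mem_decompositions_iff.mp ⟨m, hm, h⟩).encard_eq⟩

/-! ### Partitions admitting first cuts in two directions. -/

/-- A triadic partition all of whose blocks lie in thirds in direction `i` can be obtained by a
first cut in direction `i`. -/
theorem IsTriadic.exists_eq_glue {n : ℕ} {S : Set (Set (Fin d → ℝ))} (h : IsTriadic n S)
    (i : Fin d) (hsep : ∀ Q ∈ S, ∃ j, Q ⊆ third i j '' openRect 0 1) :
    ∃ (m : Fin 3 → ℕ) (T : Fin 3 → Set (Set (Fin d → ℝ))),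
      (∀ j, IsTriadic (m j) (T j)) ∧ n = ∑ j, m j ∧ S = glue i T := by
  induction h with
  | unitCube =>
    -- The undivided cube lies in no third: the coordinates 1/6 and 5/6 are more than 1/3 apart.
    obtain ⟨j, hj⟩ := hsep _ rfl
    exfalso
    have h1 : (fun _ => 1 / 2 : Fin d → ℝ) ∈ openRect (0 : Fin d → ℝ) 1 :=
      mem_openRect.mpr fun k => by norm_num
    have h2 : (fun _ => 1 / 6 : Fin d → ℝ) ∈ openRect (0 : Fin d → ℝ) 1 :=
      mem_openRect.mpr fun k => by norm_num
    have h3 : (fun _ => 5 / 6 : Fin d → ℝ) ∈ openRect (0 : Fin d → ℝ) 1 :=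
      mem_openRect.mpr fun k => by norm_num
    have g2 := hj h2
    have g3 := hj h3
    rw [image_third_openRect, mem_openRect] at g2 g3
    have g2' := (g2 i).2
    have g3' := (g3 i).1
    have g2'' := (g2 i).1
    have g3'' := (g3 i).2
    simp only [third_same, Pi.zero_apply, Pi.one_apply] at g2' g3' g2'' g3''
    linarith
  | glued k n S h ih =>
    by_cases hik : i = k
    · subst hik
      exact ⟨n, S, h, rfl, rfl⟩
    -- Scaling in direction k leaves coordinate i alone, so every piece is separated in direction i
    -- too. By induction each piece is glued along i, and `glue_comm` brings that cut to the front.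
    · have hsep' : ∀ j, ∀ Q ∈ S j, ∃ l, Q ⊆ third i l '' openRect 0 1 := by
        intro j Q hQ
        obtain ⟨l, hl⟩ := hsep _ (mem_glue.mpr ⟨j, Q, hQ, rfl⟩)
        exact ⟨l, subset_image_third_of_image_subset hik ((h j).isBlockFamily Q hQ).2 hl⟩
      choose m T hT hm hS using fun j => ih j (hsep' j)
      refine ⟨fun l => ∑ j, m j l, fun l => glue k fun j => T j l,
        fun l => IsTriadic.glued k _ _ fun j => hT j l, ?_, ?_⟩
      · rw [Finset.sum_comm]
        exact Finset.sum_congr rfl fun j _ => hm j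
      · rw [← glue_comm (Ne.symm hik)]
        exact congrArg _ (funext hS)

/-- A partition that arises from first cuts in two directions arises from both of them. -/
theorem exists_glue_glue_of_glue_eq_glue {i i' : Fin d} (hii' : i' ≠ i) {n : Fin 3 → ℕ}
    {S T : Fin 3 → Set (Set (Fin d → ℝ))} (hS : ∀ j, IsTriadic (n j) (S j))
    (hT : ∀ j, IsBlockFamily (T j)) (h : glue i S = glue i' T) :
    ∃ (m : Fin 3 → Fin 3 → ℕ) (R : Fin 3 → Fin 3 → Set (Set (Fin d → ℝ))),
      (∀ j k, IsTriadic (m j k) (R j k)) ∧ (∀ j, n j = ∑ k, m j k) ∧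
        S = fun j => glue i' (R j) := by
  have hsep : ∀ j, ∀ Q ∈ S j, ∃ l, Q ⊆ third i' l '' openRect 0 1 := by
    intro j Q hQ
    have hmem : third i j '' Q ∈ glue i' T := h ▸ mem_glue.mpr ⟨j, Q, hQ, rfl⟩
    obtain ⟨l, R, hR, hRQ⟩ := mem_glue.mp hmem
    refine ⟨l, subset_image_third_of_image_subset hii' ((hS j).isBlockFamily Q hQ).2 (j := j) ?_⟩
    rw [← hRQ]
    exact Set.image_mono (hT l R hR).2
  choose m R hR hm hSR using fun j => (hS j).exists_eq_glue i' (hsep j)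
  exact ⟨m, R, hR, hm, funext hSR⟩

end Geometry

/-! ### The generating function and its functional equation. -/

section Counting

open PowerSeries in
/-- The number of tuples of total weight `N`, for a family `P` of finite pairwise disjoint sets of
objects of given weight, is a coefficient of a power of the generating function of `P`. -/
theorem ncard_tuples {ι α : Type*} [Fintype ι] (P : ℕ → Set α)
    (hfin : ∀ n, (P n).Finite) (hdis : ∀ m n a, a ∈ P m → a ∈ P n → m = n) (N : ℕ) :
    {f : ι → α | ∃ n : ι → ℕ, (∀ j, f j ∈ P (n j)) ∧ N = ∑ j, n j}.Finite ∧
    (({f : ι → α | ∃ n : ι → ℕ, (∀ j, f j ∈ P (n j)) ∧ N = ∑ j, n j}.ncard : ℕ) : ℚ) =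
      coeff N ((mk fun n => ((P n).ncard : ℚ)) ^ Fintype.card ι) := by
  classical
  set F : ℕ → Finset α := fun n => (hfin n).toFinset with hF
  have hmem : ∀ n a, a ∈ F n ↔ a ∈ P n := fun n a => by simp [hF]
  have hset : {f : ι → α | ∃ n : ι → ℕ, (∀ j, f j ∈ P (n j)) ∧ N = ∑ j, n j} =
      ((Finset.finsuppAntidiag Finset.univ N).biUnion fun l : ι →₀ ℕ =>
        Fintype.piFinset fun j => F (l j) : Finset (ι → α)) := by
    ext f
    simp only [Set.mem_ofPred_eq, Finset.coe_biUnion, Set.mem_iUnion, Finset.mem_coe,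
      Finset.mem_finsuppAntidiag, Fintype.mem_piFinset, hmem, exists_prop]
    constructor
    · rintro ⟨n, hn, hN⟩
      exact ⟨Finsupp.equivFunOnFinite.symm n, ⟨by simp [hN], Finset.subset_univ _⟩, by simpa⟩
    · rintro ⟨l, ⟨hl, _⟩, h⟩
      exact ⟨l, h, hl.symm⟩
  rw [hset]
  refine ⟨Finset.finite_toSet _, ?_⟩
  rw [Set.ncard_coe_finset, Finset.card_biUnion, ← Finset.card_univ, ← Finset.prod_const,
    coeff_prod]
  · push_cast
    refine Finset.sum_congr rfl fun l _ => ?_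
    rw [Fintype.card_piFinset]
    push_cast
    refine Finset.prod_congr rfl fun j _ => ?_
    rw [coeff_mk, Set.ncard_eq_toFinset_card _ (hfin _)]
  · intro l _ l' _ hne
    rw [Function.onFun, Finset.disjoint_left]
    intro f hf hf'
    rw [Fintype.mem_piFinset] at hf hf'
    refine hne (Finsupp.ext fun j => ?_)
    exact hdis _ _ (f j) ((hmem _ _).mp (hf j)) ((hmem _ _).mp (hf' j))

/-- Each piece of a glued partition has fewer blocks than the whole, since the other two pieces are
nonempty; there are finitely many directions. -/
theorem finite_isTriadic {d : ℕ} (N : ℕ) : {S : Set (Set (Fin d → ℝ)) | IsTriadic N S}.Finite := by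
  induction N using Nat.strong_induction_on with
  | _ N ih =>
    have hA : {f : Fin 3 → Set (Set (Fin d → ℝ)) |
        ∀ j, f j ∈ ⋃ m ∈ Set.Iio N, {S | IsTriadic m S}}.Finite := by
      have := Set.Finite.pi' (fun _ : Fin 3 =>
        (Set.finite_Iio N).biUnion (t := fun m => {S : Set (Set (Fin d → ℝ)) | IsTriadic m S}) ih)
      exact this
    refine ((Set.finite_singleton {openRect 0 1}).union
      (Set.finite_iUnion fun i : Fin d => hA.image (glue i))).subset ?_
    intro S hS
    cases hS with
    | unitCube => exact Or.inl rfl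
    | glued i n S h =>
      refine Or.inr (Set.mem_iUnion.mpr ⟨i, S, fun j => ?_, rfl⟩)
      refine Set.mem_biUnion ?_ (h j)
      have h1 : ∑ k ∈ Finset.univ.erase j, n k + n j = ∑ k, n k :=
        Finset.sum_erase_add _ _ (Finset.mem_univ j)
      have h2 : 0 < ∑ k ∈ Finset.univ.erase j, n k :=
        Finset.sum_pos (fun k _ => (h k).pos)
          ⟨j + 1, Finset.mem_erase.mpr ⟨(by decide : ∀ j : Fin 3, j + 1 ≠ j) j, Finset.mem_univ _⟩⟩
      rw [Set.mem_Iio]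
      omega

/-- The tuples of triadic partitions of the square with `N` blocks altogether. -/
def triadicTuples (ι : Type*) [Fintype ι] (N : ℕ) : Set (ι → Set (Set (Fin 2 → ℝ))) :=
  {f | ∃ n : ι → ℕ, (∀ j, f j ∈ {S | IsTriadic (n j) S}) ∧ N = ∑ j, n j}

/-- The generating function of the triadic partitions of the square by number of blocks. -/
noncomputable def triadicSeries : PowerSeries ℚ :=
  PowerSeries.mk fun n => ({S : Set (Set (Fin 2 → ℝ)) | IsTriadic n S}.ncard : ℚ)

theorem ncard_triadicTuples (ι : Type*) [Fintype ι] (N : ℕ) :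
    (triadicTuples ι N).Finite ∧ ((triadicTuples ι N).ncard : ℚ) =
      PowerSeries.coeff N (triadicSeries ^ Fintype.card ι) :=
  ncard_tuples _ finite_isTriadic (fun _ _ _ h h' => h.eq_of_eq h') N

theorem triadicTuples_isBlockFamily {ι : Type*} [Fintype ι] {N : ℕ}
    {f : ι → Set (Set (Fin 2 → ℝ))} (hf : f ∈ triadicTuples ι N) (j : ι) :
    IsBlockFamily (f j) := by
  obtain ⟨n, hn, _⟩ := hf
  exact (hn j).isBlockFamily

theorem glue_injOn (i : Fin 2) (N : ℕ) :
    Set.InjOn (glue i) (triadicTuples (Fin 3) N) := fun _ hf _ hg h =>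
  glue_injective (triadicTuples_isBlockFamily hf) (triadicTuples_isBlockFamily hg) h

theorem glue_glue_injOn (N : ℕ) :
    Set.InjOn (fun f : Fin 3 × Fin 3 → Set (Set (Fin 2 → ℝ)) =>
      glue 0 fun j => glue 1 fun k => f (j, k)) (triadicTuples (Fin 3 × Fin 3) N) := by
  intro f hf g hg h
  have hf' := triadicTuples_isBlockFamily hf
  have hg' := triadicTuples_isBlockFamily hg
  have h1 := glue_injective (fun j => isBlockFamily_glue fun k => hf' (j, k))
    (fun j => isBlockFamily_glue fun k => hg' (j, k)) h
  funext ⟨j, k⟩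
  exact congrFun (glue_injective (fun k => hf' (j, k)) (fun k => hg' (j, k)) (congrFun h1 j)) k

theorem setOf_isTriadic_eq (N : ℕ) :
    {S : Set (Set (Fin 2 → ℝ)) | IsTriadic N S} =
      {S | N = 1 ∧ S = {openRect 0 1}} ∪
        (glue 0 '' triadicTuples (Fin 3) N ∪ glue 1 '' triadicTuples (Fin 3) N) := by
  ext S
  constructor
  · intro hS
    cases hS with
    | unitCube => exact Or.inl ⟨rfl, rfl⟩
    | glued i n S h =>
      right
      fin_cases i
      · exact Or.inl ⟨S, ⟨n, h, rfl⟩, rfl⟩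
      · exact Or.inr ⟨S, ⟨n, h, rfl⟩, rfl⟩
  · rintro (⟨rfl, rfl⟩ | ⟨f, ⟨n, hn, rfl⟩, rfl⟩ | ⟨f, ⟨n, hn, rfl⟩, rfl⟩)
    · exact IsTriadic.unitCube
    · exact IsTriadic.glued 0 n f hn
    · exact IsTriadic.glued 1 n f hn

/-- The overlap in the inclusion–exclusion: nine independent partitions in a 3 × 3 grid, the source
of T^9. -/
theorem image_glue_inter_image_glue (N : ℕ) :
    glue 0 '' triadicTuples (Fin 3) N ∩ glue 1 '' triadicTuples (Fin 3) N =
      (fun f : Fin 3 × Fin 3 → Set (Set (Fin 2 → ℝ)) =>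
        glue 0 fun j => glue 1 fun k => f (j, k)) '' triadicTuples (Fin 3 × Fin 3) N := by
  ext S
  constructor
  · rintro ⟨⟨f, ⟨n, hn, hN⟩, rfl⟩, ⟨g, hg, hfg⟩⟩
    obtain ⟨m, R, hR, hm, rfl⟩ := exists_glue_glue_of_glue_eq_glue (i := 0) (i' := 1) (by decide)
      hn (triadicTuples_isBlockFamily hg) hfg.symm
    refine ⟨fun p => R p.1 p.2, ⟨fun p => m p.1 p.2, fun p => hR p.1 p.2, ?_⟩, rfl⟩
    rw [hN, Fintype.sum_prod_type]
    exact Finset.sum_congr rfl fun j _ => hm j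
  · rintro ⟨f, ⟨n, hn, hN⟩, rfl⟩
    refine ⟨⟨_, ⟨fun j => ∑ k, n (j, k), fun j => IsTriadic.glued 1 _ _ fun k => hn (j, k), ?_⟩,
      rfl⟩, ⟨_, ⟨fun k => ∑ j, n (j, k), fun k => IsTriadic.glued 0 _ _ fun j => hn (j, k), ?_⟩,
      (glue_comm (by decide) fun j k => f (j, k)).symm⟩⟩
    · rw [hN, Fintype.sum_prod_type]
    · rw [hN, Fintype.sum_prod_type_right]

/-- Keeps the undivided square from being counted again among the glued partitions. -/
theorem triadicTuples_one : triadicTuples (Fin 3) 1 = ∅ := by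
  rw [Set.eq_empty_iff_forall_notMem]
  rintro f ⟨n, hn, hN⟩
  have h0 := (hn 0).pos
  have h1 := (hn 1).pos
  rw [Fin.sum_univ_three] at hN
  omega

open PowerSeries in
theorem triadicSeries_eq :
    triadicSeries = X + 2 * triadicSeries ^ 3 - triadicSeries ^ 9 := by
  ext N
  obtain ⟨hA, hAc⟩ := ncard_triadicTuples (Fin 3) N
  obtain ⟨_, hBc⟩ := ncard_triadicTuples (Fin 3 × Fin 3) N
  rw [Fintype.card_fin] at hAc
  rw [Fintype.card_prod, Fintype.card_fin] at hBc
  have hunion := Set.ncard_union_add_ncard_inter (glue 0 '' triadicTuples (Fin 3) N)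
    (glue 1 '' triadicTuples (Fin 3) N) (hA.image _) (hA.image _)
  rw [image_glue_inter_image_glue, (glue_glue_injOn N).ncard_image, (glue_injOn 0 N).ncard_image,
    (glue_injOn 1 N).ncard_image] at hunion
  have htotal : {S : Set (Set (Fin 2 → ℝ)) | IsTriadic N S}.ncard = (if N = 1 then 1 else 0) +
      (glue 0 '' triadicTuples (Fin 3) N ∪ glue 1 '' triadicTuples (Fin 3) N).ncard := by
    rw [setOf_isTriadic_eq]
    by_cases hN : N = 1
    · subst hN
      simp [triadicTuples_one]
    · simp [hN]
  have h2 : (2 : ℚ⟦X⟧) = C (2 : ℚ) := (map_ofNat C 2).symm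
  rw [map_sub, map_add, h2, coeff_C_mul, ← hAc, ← hBc, coeff_X, triadicSeries, coeff_mk, htotal]
  have := congrArg (Nat.cast : ℕ → ℚ) hunion
  push_cast at this ⊢
  linarith

theorem constantCoeff_triadicSeries : PowerSeries.constantCoeff triadicSeries = 0 := by
  have : {S : Set (Set (Fin 2 → ℝ)) | IsTriadic 0 S} = ∅ :=
    Set.eq_empty_iff_forall_notMem.mpr fun S hS => (IsTriadic.pos hS).ne rfl
  rw [← PowerSeries.coeff_zero_eq_constantCoeff_apply, triadicSeries, PowerSeries.coeff_mk, this]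
  simp

end Counting

/-! ### Transfer to the step-by-step definition and conclusion. -/

theorem setOf_isTriadic_eq_decompositions {d : ℕ} (n : ℕ) :
    {S : Set (Set (Fin d → ℝ)) | IsTriadic n S} = decompositions d 3 n :=
  Set.ext fun _ => mem_decompositions_iff.symm

theorem coeff_triadicSeries (n : ℕ) :
    PowerSeries.coeff n triadicSeries = (catalanC 2 3 n : ℚ) := by
  rw [triadicSeries, PowerSeries.coeff_mk, setOf_isTriadic_eq_decompositions, catalanC]

theorem corollary9 (n : ℕ) :
    (partitionsInto 2 3 n).encard = (catalanC 2 3 n : ℕ∞) ∧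
    (decompositions 2 3 n).Finite ∧
    (Odd n →
      (catalanC 2 3 n : ℚ) = 1 / (n : ℚ) *
        ∑ i ∈ Finset.range ((n - 1) / 8 + 1),
          (((3 * ((n - 1) / 2 - i))! : ℚ) /
              ((n - 1)! * ((n - 1) / 2 - 4 * i)! * (i)!)) *
            (-1) ^ i * 2 ^ ((n - 1) / 2 - 4 * i)) ∧
    (Even n → catalanC 2 3 n = 0) := by
  have hfin : (decompositions 2 3 n).Finite :=
    setOf_isTriadic_eq_decompositions (d := 2) n ▸ finite_isTriadic n
  refine ⟨?_, hfin, ?_, ?_⟩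
  · rw [partitionsInto_eq_decompositions, catalanC, hfin.cast_ncard_eq]
  · rintro ⟨M, rfl⟩
    have e1 : 2 * M + 1 - 1 = 2 * M := by omega
    have e2 : 2 * M / 2 = M := by omega
    have e3 : 2 * M / 8 = M / 4 := by omega
    rw [← coeff_triadicSeries, e1, e2, e3]
    exact coeff_of_functional_equation constantCoeff_triadicSeries triadicSeries_eq M
  · intro hn
    have hempty : decompositions 2 3 n = ∅ := by
      rw [Set.eq_empty_iff_forall_notMem]
      -- Every step adds two blocks to the initial one, so the count 1 + 2m is odd.
      rintro S ⟨m, hm, _⟩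
      obtain ⟨k, hk⟩ := hn
      omega
    rw [catalanC, hempty, Set.ncard_empty]
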